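/- A sequence $(a_n)_{n\in\omega}$ in a group $G$ is called a $T$-sequence if it converges to the neutral element in some non-discrete Hausdorff group topology on $G$; the topology determined by a $T$-sequence $(a_n)$ is the strongest group topology on $G$ in which $(a_n)$ converges to the neutral element, and a topological group is said to be determined by a $T$-sequence if its topology arises in this way from some $T$-sequence. For group topologies $\tau_1,\tau_2$ on $G$, $\tau_1\vee\tau_2$ denotes the weakest topology on $G$ for which both identity maps $(G,\tau_1\vee\tau_2)\to(G,\tau_i)$, $i=1,2$, are continuous. A topological group is complete if it is complete with respect to its two-sided uniformity (this is implied by completeness with respect to the left or the right uniformity). **Theorem 5.** (1) Let $\tau_1$ and $\tau_2$ be the group topologies on a countable group $G$ determined by $T$-sequences $(a_n)_{n\in\omega}$ and $(b_n)_{n\in\omega}$, respectively. If there is a non-identity element $g\in G$ such that for every $n_0\in\omega$ there exist $n,m\ge n_0$ with $g=a_n^{-1}b_m$, then the topological group $(G,\tau_1\vee\tau_2)$ is not complete, and it is not determined by a $T$-sequence. (2) Let $c$ be a non-zero integer. If $(a_n)$ and $(a_n+c)$ are both $T$-sequences in the group $\mathbb Z$ and $\tau_1,\tau_2$ are the topologies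 they determine, then $(\mathbb Z,\tau_1\vee\tau_2)$ is not complete and is not determined by a $T$-sequence. Moreover, there exists a sequence $(a_n)$ of integers such that $(a_n)$ and $(a_n+c)$ are both $T$-sequences in $\mathbb Z$; hence there are two group topologies on $\mathbb Z$ determined by $T$-sequences whose supremum is not complete and not determined by a $T$-sequence. -/

import Mathlib

open Filter Topology

namespace TSeq

universe u

variable {G : Type u} [Group G]

/-- The sequence `a` converges to the neutral element in the group topology `t`. -/
def ConvergesToOne (t : GroupTopology G) (a : ℕ → G) : Prop :=
  Tendsto a atTop (@nhds G t.toTopologicalSpace 1)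

/-- `a` is a `T`-sequence: it converges to the neutral element in some non-discrete Hausdorff
group topology. -/
def IsTSequence (a : ℕ → G) : Prop :=
  ∃ t : GroupTopology G, @T2Space G t.toTopologicalSpace ∧
    ¬ @DiscreteTopology G t.toTopologicalSpace ∧ ConvergesToOne t a

/-- The strongest group topology on `G` in which `a` converges to the neutral element.
In Mathlib's order on topologies `t ≤ s` means that `t` is stronger (finer) than `s`, so this is
an infimum; `isLeast_strongest` checks that it is attained. -/
def strongest (a : ℕ → G) : GroupTopology G :=
  sInf {t | ConvergesToOne t a}

theorem isLeast_strongest (a : ℕ → G) :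
    IsLeast {t : GroupTopology G | ConvergesToOne t a} (strongest a) := by
  refine ⟨?_, fun t ht => sInf_le ht⟩
  change Tendsto a atTop (@nhds G (strongest a).toTopologicalSpace 1)
  rw [strongest, GroupTopology.toTopologicalSpace_sInf, nhds_sInf]
  refine tendsto_iInf.2 fun s => tendsto_iInf.2 ?_
  rintro ⟨t, ht, rfl⟩
  exact ht

/-- The group `G` with the topology `t` is determined by some `T`-sequence. -/
def IsDetermined (t : GroupTopology G) : Prop :=
  ∃ a : ℕ → G, IsTSequence a ∧ t = strongest a

/-- The supremum `t₁ ∨ t₂` in the order by strength: the weakest topology for which both identity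
maps to `(G, t₁)` and `(G, t₂)` are continuous. It is Mathlib's `t₁ ⊓ t₂`, as Mathlib orders
topologies the other way round. -/
def join (t₁ t₂ : GroupTopology G) : GroupTopology G :=
  t₁ ⊓ t₂

/-- `G` with the topology `t` is complete with respect to its two-sided uniformity (the supremum,
in the order by strength, of the left and the right uniformities), that is, Raikov complete.
A group that is complete for its left or its right uniformity is complete in this sense. -/
def IsComplete (t : GroupTopology G) : Prop :=
  letI := t.toTopologicalSpace
  haveI := t.toIsTopologicalGroup
  @CompleteSpace G
    (IsTopologicalGroup.leftUniformSpace G ⊓ IsTopologicalGroup.rightUniformSpace G)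

end TSeq

/-! If g = a_n⁻¹ b_m for arbitrarily large n, m, then some b_{m_k} = a_{n_k} g tends to g in the
first topology and to 1 in the second. So it is Cauchy in the join but has no cluster point there,
both topologies being Hausdorff; this kills completeness. A topology determined by `d` on a
countable group is Hausdorff and at least as fine as the group topology coherent with an increasing
sequence of compact sets `products d e n`. A Cauchy sequence leaving every one of them would have a
subsequence whose quotients form a closed set missing 1 (`frequently_mem_products_of_cauchy`). Hence
it returns infinitely often to one compact set and has a cluster point, so the join is not
determined. -/

namespace TSeq

open Set Pointwise

/-! ### Products of coherent topologies on compact filtrations -/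

section CompactFiltration

variable {X : Type*} [TopologicalSpace X]

/-- `U` is relatively open in every member of the family `K`. -/
def RelOpen (K : ℕ → Set X) (U : Set X) : Prop :=
  ∀ n, ∀ x ∈ U, x ∈ K n → U ∈ 𝓝[K n] x

/-- The topology on `X` coherent with the family `K` of subspaces. -/
@[reducible]
def coherentTopology (K : ℕ → Set X) : TopologicalSpace X where
  IsOpen := RelOpen K
  isOpen_univ := fun _ _ _ _ => univ_mem
  isOpen_inter := fun _ _ hs ht n x hx hK => inter_mem (hs n x hx.1 hK) (ht n x hx.2 hK)
  isOpen_sUnion := by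
    rintro S hS n x ⟨s, hs, hx⟩ hK
    exact mem_of_superset (hS s hs n x hx hK) (subset_sUnion_of_mem hs)

/-- Inside the compact Hausdorff space `K` the tube lemma fits an open box between `A ×ˢ B` and `V`;
local compactness then fits a compact box in between. -/
theorem exists_compact_enlargement [T2Space X] {K A B : Set X} {V : Set (X × X)}
    (hK : IsCompact K) (hA : IsCompact A) (hB : IsCompact B) (hAK : A ⊆ K) (hBK : B ⊆ K)
    (hAB : A ×ˢ B ⊆ V) (hV : ∀ p ∈ V, p ∈ K ×ˢ K → V ∈ 𝓝[K ×ˢ K] p) :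
    ∃ A' B' : Set X, IsCompact A' ∧ IsCompact B' ∧ A' ⊆ K ∧ B' ⊆ K ∧ A' ×ˢ B' ⊆ V ∧
      (∀ a ∈ A, A' ∈ 𝓝[K] a) ∧ ∀ b ∈ B, B' ∈ 𝓝[K] b := by
  have : CompactSpace K := isCompact_iff_compactSpace.1 hK
  let q : K × K → X × X := Prod.map (↑) (↑)
  have hopen : IsOpen (q ⁻¹' V) := by
    rw [isOpen_iff_mem_nhds]
    rintro ⟨x, y⟩ hxy
    have h := hV (x, y) hxy ⟨x.2, y.2⟩
    have hq : Tendsto q (𝓝 (x, y)) (𝓝[K ×ˢ K] ((x : X), (y : X))) := by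
      refine tendsto_nhdsWithin_iff.2 ⟨?_, Eventually.of_forall fun p => ⟨p.1.2, p.2.2⟩⟩
      exact (continuous_subtype_val.prodMap continuous_subtype_val).tendsto (x, y)
    exact hq h
  have compact_pre : ∀ {S : Set X}, IsCompact S → IsCompact ((↑) ⁻¹' S : Set K) := fun hS =>
    (hS.isClosed.preimage continuous_subtype_val).isCompact
  obtain ⟨O₁, O₂, hO₁, hO₂, hA₁, hB₂, hO⟩ := generalized_tube_lemma (compact_pre hA)
    (compact_pre hB) hopen (fun p hp => hAB (a := q p) ⟨hp.1, hp.2⟩)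
  obtain ⟨C₁, hC₁, hAC, hCO₁⟩ := exists_compact_between (compact_pre hA) hO₁ hA₁
  obtain ⟨C₂, hC₂, hBC, hCO₂⟩ := exists_compact_between (compact_pre hB) hO₂ hB₂
  have nhds_image : ∀ {S : Set X} {C : Set K}, S ⊆ K → ((↑) ⁻¹' S : Set K) ⊆ interior C →
      ∀ a ∈ S, ((↑) '' C : Set X) ∈ 𝓝[K] a := by
    intro S C hSK hSC a ha
    have h : C ∈ 𝓝 (⟨a, hSK ha⟩ : K) := mem_interior_iff_mem_nhds.1 (hSC ha)
    rw [nhdsWithin_eq_map_subtype_coe (hSK ha)]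
    exact image_mem_map h
  refine ⟨(↑) '' C₁, (↑) '' C₂, hC₁.image continuous_subtype_val,
    hC₂.image continuous_subtype_val, Subtype.coe_image_subset _ _, Subtype.coe_image_subset _ _,
    ?_, nhds_image hAK hAC, nhds_image hBK hBC⟩
  rintro ⟨_, _⟩ ⟨⟨x, hx, rfl⟩, ⟨y, hy, rfl⟩⟩
  exact hO (a := (x, y)) ⟨hCO₁ hx, hCO₂ hy⟩

/-- The product of two copies of the coherent topology is coherent with the squares `K n ×ˢ K n`. -/
theorem exists_relOpen_prod_subset [T2Space X] {K : ℕ → Set X} (hK : ∀ n, IsCompact (K n))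
    (hmono : Monotone K) (hcov : ∀ x, ∃ n, x ∈ K n) {V : Set (X × X)}
    (hV : ∀ n, ∀ p ∈ V, p ∈ K n ×ˢ K n → V ∈ 𝓝[K n ×ˢ K n] p) {x y : X} (hxy : (x, y) ∈ V) :
    ∃ A B : Set X, x ∈ A ∧ y ∈ B ∧ RelOpen K A ∧ RelOpen K B ∧ A ×ˢ B ⊆ V := by
  obtain ⟨n₁, hx⟩ := hcov x
  obtain ⟨n₂, hy⟩ := hcov y
  obtain ⟨N, hN₁, hN₂⟩ : ∃ N, n₁ ≤ N ∧ n₂ ≤ N := ⟨_, le_max_left _ _, le_max_right _ _⟩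
  let Q : ℕ → Set X × Set X → Prop := fun n P => IsCompact P.1 ∧ IsCompact P.2 ∧
    P.1 ⊆ K (N + n) ∧ P.2 ⊆ K (N + n) ∧ P.1 ×ˢ P.2 ⊆ V
  have step : ∀ n P, ∃ P', Q n P → Q (n + 1) P' ∧
      (∀ a ∈ P.1, P'.1 ∈ 𝓝[K (N + (n + 1))] a) ∧ ∀ b ∈ P.2, P'.2 ∈ 𝓝[K (N + (n + 1))] b := by
    intro n P
    by_cases hP : Q n P
    · obtain ⟨h₁, h₂, h₃, h₄, h₅⟩ := hP
      have hle : K (N + n) ⊆ K (N + (n + 1)) := hmono (by omega)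
      obtain ⟨A', B', h⟩ := exists_compact_enlargement (hK (N + (n + 1))) h₁ h₂ (h₃.trans hle)
        (h₄.trans hle) h₅ (hV _)
      exact ⟨(A', B'), fun _ => ⟨⟨h.1, h.2.1, h.2.2.1, h.2.2.2.1, h.2.2.2.2.1⟩,
        h.2.2.2.2.2⟩⟩
    -- Junk value, so that `choose` gives a total function to iterate.
    · exact ⟨P, fun h => absurd h hP⟩
  choose f hf using step
  let S : ℕ → Set X × Set X := fun n => Nat.rec ({x}, {y}) (fun n P => f n P) n
  have hS : ∀ n, Q n (S n) := by
    intro n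
    induction n with
    | zero =>
      refine ⟨isCompact_singleton, isCompact_singleton,
        singleton_subset_iff.2 (hmono hN₁ hx),
        singleton_subset_iff.2 (hmono hN₂ hy), ?_⟩
      change ({x} : Set X) ×ˢ ({y} : Set X) ⊆ V
      rw [singleton_prod_singleton]
      exact singleton_subset_iff.2 hxy
    | succ n ih => exact (hf n (S n) ih).1
  have hS₁ : ∀ n, ∀ a ∈ (S n).1, (S (n + 1)).1 ∈ 𝓝[K (N + (n + 1))] a :=
    fun n => (hf n (S n) (hS n)).2.1
  have hS₂ : ∀ n, ∀ b ∈ (S n).2, (S (n + 1)).2 ∈ 𝓝[K (N + (n + 1))] b :=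
    fun n => (hf n (S n) (hS n)).2.2
  have grow : ∀ T : ℕ → Set X, (∀ n, T n ⊆ K (N + n)) →
      (∀ n, ∀ a ∈ T n, T (n + 1) ∈ 𝓝[K (N + (n + 1))] a) →
      Monotone T ∧ RelOpen K (⋃ n, T n) := by
    intro T hTK hT
    have hmonoT : Monotone T := monotone_nat_of_le_succ fun n a ha =>
      mem_of_mem_nhdsWithin (hmono (by omega : N + n ≤ N + (n + 1)) (hTK n ha)) (hT n a ha)
    refine ⟨hmonoT, fun m a ha _ => ?_⟩
    obtain ⟨n, hn⟩ := mem_iUnion.1 ha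
    -- At stage `max n m` the ambient compact set already contains `K m`.
    have h := hT (max n m) a (hmonoT (le_max_left _ _) hn)
    have hle : K m ⊆ K (N + (max n m + 1)) := hmono (by omega)
    exact mem_of_superset (nhdsWithin_mono a hle h) (subset_iUnion T _)
  obtain ⟨m₁, r₁⟩ := grow (fun n => (S n).1) (fun n => (hS n).2.2.1) hS₁
  obtain ⟨m₂, r₂⟩ := grow (fun n => (S n).2) (fun n => (hS n).2.2.2.1) hS₂
  refine ⟨_, _, mem_iUnion.2 ⟨0, rfl⟩, mem_iUnion.2 ⟨0, rfl⟩, r₁, r₂, ?_⟩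
  rintro ⟨a, b⟩ ⟨ha, hb⟩
  obtain ⟨i, hi⟩ := mem_iUnion.1 ha
  obtain ⟨j, hj⟩ := mem_iUnion.1 hb
  exact (hS (max i j)).2.2.2.2 ⟨m₁ (le_max_left i j) hi, m₂ (le_max_right i j) hj⟩

end CompactFiltration

/-! ### Compact filtration of a group by words -/

section GroupFiltration

variable {H : Type*} [Group H]

/-- The group topology coherent with a compact filtration of a Hausdorff topological group. -/
theorem isTopologicalGroup_coherentTopology [t : TopologicalSpace H] [IsTopologicalGroup H]
    [T2Space H] {K : ℕ → Set H} (hK : ∀ n, IsCompact (K n)) (hmono : Monotone K)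
    (hcov : ∀ x, ∃ n, x ∈ K n) (hmul : ∀ m n, K m * K n ⊆ K (m + n)) (hinv : ∀ n, (K n)⁻¹ ⊆ K n) :
    @IsTopologicalGroup H (coherentTopology K) _ := by
  refine @IsTopologicalGroup.mk H (coherentTopology K) _
    (@ContinuousMul.mk H (coherentTopology K) _ ?_)
    (@ContinuousInv.mk H (coherentTopology K) _ ?_)
  · let := coherentTopology K
    refine continuous_def.2 fun U (hU : @RelOpen H t K U) => isOpen_prod_iff.2 ?_
    intro x y hxy
    have key := @exists_relOpen_prod_subset H t _ K hK hmono hcov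
      ((fun p : H × H => p.1 * p.2) ⁻¹' U) ?_ x y hxy
    · obtain ⟨A, B, hA, hB, rA, rB, hAB⟩ := key
      exact ⟨A, B, rA, rB, hA, hB, hAB⟩
    · let := t
      rintro n ⟨u, v⟩ huv ⟨hu, hv⟩
      have h := hU (n + n) (u * v) huv (hmul n n (mul_mem_mul hu hv))
      have hc : Tendsto (fun p : H × H => p.1 * p.2) (𝓝[K n ×ˢ K n] (u, v))
          (𝓝[K (n + n)] (u * v)) := by
        refine tendsto_nhdsWithin_iff.2 ⟨(continuous_mul.tendsto (u, v)).mono_left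
          nhdsWithin_le_nhds, ?_⟩
        filter_upwards [self_mem_nhdsWithin] with p hp
        exact hmul n n (mul_mem_mul hp.1 hp.2)
      exact hc h
  · refine @Continuous.mk H H (coherentTopology K) (coherentTopology K) _ fun U hU n x hx hxK => ?_
    have h := hU n x⁻¹ hx (hinv n (Set.inv_mem_inv.2 hxK))
    have hc : Tendsto (fun p : H => p⁻¹) (𝓝[K n] x) (𝓝[K n] x⁻¹) := by
      refine tendsto_nhdsWithin_iff.2 ⟨(continuous_inv.tendsto x).mono_left
        nhdsWithin_le_nhds, ?_⟩
      filter_upwards [self_mem_nhdsWithin] with p hp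
      exact hinv n (Set.inv_mem_inv.2 hp)
    exact hc h

/-- Symmetric sets containing `1`, the terms of `d` and the first terms of an enumeration `e`. -/
def generators (d e : ℕ → H) (n : ℕ) : Set H :=
  (insert 1 (range d) ∪ e '' Iio n) ∪ (insert 1 (range d) ∪ e '' Iio n)⁻¹

/-- Products of `n` generators of index `n`. -/
def products (d e : ℕ → H) (n : ℕ) : Set H :=
  generators d e n ^ n

theorem one_mem_generators (d e : ℕ → H) (n : ℕ) : (1 : H) ∈ generators d e n :=
  Or.inl (Or.inl (mem_insert _ _))

theorem generators_mono (d e : ℕ → H) : Monotone (generators d e) := by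
  intro m n h
  have h' : insert 1 (range d) ∪ e '' Iio m ⊆ insert 1 (range d) ∪ e '' Iio n :=
    union_subset_union_right _ (image_mono (Iio_subset_Iio h))
  exact union_subset_union h' (Set.inv_subset_inv.2 h')

theorem products_mono (d e : ℕ → H) : Monotone (products d e) := fun _ n h =>
  (Set.pow_subset_pow_left (generators_mono d e h)).trans
    (Set.pow_subset_pow_right (one_mem_generators d e n) h)

theorem products_mul (d e : ℕ → H) (m n : ℕ) :
    products d e m * products d e n ⊆ products d e (m + n) := by
  rw [products, products, products, pow_add]
  exact mul_subset_mul (Set.pow_subset_pow_left (generators_mono d e (Nat.le_add_right m n)))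
    (Set.pow_subset_pow_left (generators_mono d e (Nat.le_add_left n m)))

theorem products_inv (d e : ℕ → H) (n : ℕ) : (products d e n)⁻¹ = products d e n := by
  rw [products, ← inv_pow, generators, Set.union_inv, inv_inv, Set.union_comm]

theorem mem_products_one (d e : ℕ → H) (i : ℕ) : d i ∈ products d e 1 := by
  rw [products, pow_one]
  exact Or.inl (Or.inl (mem_insert_of_mem _ (mem_range_self i)))

theorem mem_products_succ (d e : ℕ → H) (i : ℕ) : e i ∈ products d e (i + 1) := by
  have h : e i ∈ generators d e (i + 1) :=
    Or.inl (Or.inr (mem_image_of_mem e (Nat.lt_succ_self i)))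
  have := Set.pow_subset_pow_right (one_mem_generators d e (i + 1)) (Nat.le_add_left 1 i)
  rw [pow_one] at this
  exact this h

theorem isCompact_products [TopologicalSpace H] [IsTopologicalGroup H] {d : ℕ → H} (e : ℕ → H)
    (hd : Tendsto d atTop (𝓝 1)) (n : ℕ) : IsCompact (products d e n) := by
  have h : IsCompact (insert 1 (range d) ∪ e '' Iio n) :=
    hd.isCompact_insert_range.union ((finite_Iio n).image e).isCompact
  have hg : IsCompact (generators d e n) := h.union h.inv
  have hpow : ∀ k, IsCompact (generators d e n ^ k) := by
    intro k
    induction k with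
    | zero => simp
    | succ k ih => rw [pow_succ]; exact ih.mul hg
  exact hpow n

/-- In the strongest topology, the complement of a set with finite traces on the compact
filtration is a neighbourhood of `1` if it contains `1`. -/
theorem compl_mem_nhds_strongest (d e : ℕ → H) (he : Function.Surjective e)
    (hT : @T2Space H (strongest d).toTopologicalSpace) {E : Set H}
    (hE : ∀ n, (E ∩ products d e n).Finite) (h1 : (1 : H) ∉ E) :
    Eᶜ ∈ @nhds H (strongest d).toTopologicalSpace 1 := by
  let := (strongest d).toTopologicalSpace
  have := (strongest d).toIsTopologicalGroup
  have hd : Tendsto d atTop (𝓝 1) := (isLeast_strongest d).1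
  have hcov : ∀ x, ∃ n, x ∈ products d e n := fun x => by
    obtain ⟨i, rfl⟩ := he x
    exact ⟨_, mem_products_succ d e i⟩
  let s : GroupTopology H :=
    { toTopologicalSpace := coherentTopology (products d e)
      toIsTopologicalGroup := isTopologicalGroup_coherentTopology (isCompact_products e hd)
        (products_mono d e) hcov (products_mul d e) (fun n => (products_inv d e n).subset) }
  have hs : ConvergesToOne s d := by
    intro U hU
    obtain ⟨W, hWU, hW, h1W⟩ := (@mem_nhds_iff H s.toTopologicalSpace 1 U).1 hU
    have hone : (1 : H) ∈ products d e 1 := by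
      rw [products, pow_one]; exact one_mem_generators d e 1
    have hd' : Tendsto d atTop (𝓝[products d e 1] 1) :=
      tendsto_nhdsWithin_iff.2 ⟨hd, Eventually.of_forall (mem_products_one d e)⟩
    exact mem_of_superset (hd' (hW 1 1 h1W hone)) (preimage_mono hWU)
  -- Sets open in the coherent topology are therefore open in the strongest one.
  have hle : strongest d ≤ s := (isLeast_strongest d).2 hs
  have hopen : IsOpen[s.toTopologicalSpace] Eᶜ := by
    intro n x hx _
    have h : (E ∩ products d e n)ᶜ ∈ 𝓝 x :=
      (hE n).isClosed.isOpen_compl.mem_nhds fun hx' => hx hx'.1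
    filter_upwards [mem_nhdsWithin_of_mem_nhds h, self_mem_nhdsWithin] with z hz hzK hzE
    exact hz ⟨hzE, hzK⟩
  have hopen' : IsOpen Eᶜ := GroupTopology.toTopologicalSpace_le.2 hle _ hopen
  exact hopen'.mem_nhds h1

/-- A Cauchy sequence for the strongest topology meets a member of the compact filtration
infinitely often. -/
theorem frequently_mem_products_of_cauchy (d e : ℕ → H) (he : Function.Surjective e)
    (hT : @T2Space H (strongest d).toTopologicalSpace) {x : ℕ → H}
    (hx : ∀ U ∈ @nhds H (strongest d).toTopologicalSpace 1,
      ∃ N, ∀ k ≥ N, ∀ l ≥ N, (x k)⁻¹ * x l ∈ U) :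
    ∃ n, ∃ᶠ k in atTop, x k ∈ products d e n := by
  by_contra! hcon
  have hout : ∀ n, ∀ᶠ k in atTop, x k ∉ products d e n := fun n => by
    simpa [Filter.Frequently] using hcon n
  have hin : ∀ k, ∃ n, x k ∈ products d e n := fun k => by
    obtain ⟨i, hi⟩ := he (x k)
    exact ⟨i + 1, hi ▸ mem_products_succ d e i⟩
  choose m hm using hin
  -- Each pair is a level and an index. A new term avoids (level of the earlier term) + (new level),
  -- so its quotient by that term avoids the new level.
  obtain ⟨f, -, hf⟩ := exists_seq_of_forall_finset_exists (fun _ : ℕ × ℕ => True)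
    (fun p q => p.1 < q.1 ∧ p.2 < q.2 ∧ x q.2 ∉ products d e (m p.2 + q.1)) (by
      intro s _
      obtain ⟨j, hj⟩ := (s.image Prod.fst).bddAbove
      have h : ∀ᶠ k in atTop, ∀ p ∈ s, p.2 < k ∧ x k ∉ products d e (m p.2 + (j + 1)) :=
        (Finset.eventually_all s).2 fun p _ => (eventually_gt_atTop p.2).and (hout _)
      obtain ⟨k, hk⟩ := h.exists
      refine ⟨(j + 1, k), trivial, fun p hp => ⟨?_, hk p hp⟩⟩
      exact Nat.lt_succ_of_le (hj (Finset.mem_coe.2 (Finset.mem_image_of_mem _ hp))))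
  have hm₁ : StrictMono fun i => (f i).1 := fun i j h => (hf i j h).1
  have hm₂ : StrictMono fun i => (f i).2 := fun i j h => (hf i j h).2.1
  let E : Set H := {z | ∃ i j, i < j ∧ z = (x (f i).2)⁻¹ * x (f j).2}
  have hlt : ∀ i j n, i < j → (x (f i).2)⁻¹ * x (f j).2 ∈ products d e n → j < n := by
    intro i j n hij hz
    by_contra! hn
    refine (hf i j hij).2.2 (products_mono d e
      (Nat.add_le_add_left (hn.trans (hm₁.id_le j)) (m (f i).2)) ?_)
    have := products_mul d e _ _ (mul_mem_mul (hm (f i).2) hz)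
    rwa [mul_inv_cancel_left] at this
  have hE : ∀ n, (E ∩ products d e n).Finite := by
    intro n
    refine (((finite_Iio n).prod (finite_Iio n)).image
      fun p : ℕ × ℕ => (x (f p.1).2)⁻¹ * x (f p.2).2).subset ?_
    rintro _ ⟨⟨i, j, hij, rfl⟩, hz⟩
    have hj := hlt i j n hij hz
    exact ⟨(i, j), ⟨hij.trans hj, hj⟩, rfl⟩
  have h1 : (1 : H) ∉ E := by
    rintro ⟨i, j, hij, hz⟩
    have : (1 : H) ∈ products d e 0 := by simp [products]
    exact absurd (hlt i j 0 hij (hz ▸ this)) (Nat.not_lt_zero j)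
  obtain ⟨N, hN⟩ := hx _ (compl_mem_nhds_strongest d e he hT hE h1)
  exact hN _ (hm₂.id_le N) _ ((Nat.le_succ N).trans (hm₂.id_le (N + 1)))
    ⟨N, N + 1, Nat.lt_succ_self N, rfl⟩

end GroupFiltration

/-! ### Sequences with two different limits -/

section Join

variable {H : Type*} [Group H]

theorem IsTSequence.t2Space_strongest {a : ℕ → H} (ha : IsTSequence a) :
    @T2Space H (strongest a).toTopologicalSpace := by
  obtain ⟨t, h2, -, hc⟩ := ha
  exact t2Space_antitone (GroupTopology.toTopologicalSpace_le.2 ((isLeast_strongest a).2 hc)) h2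

theorem nhds_join (t₁ t₂ : GroupTopology H) (x : H) :
    @nhds H (join t₁ t₂).toTopologicalSpace x =
      @nhds H t₁.toTopologicalSpace x ⊓ @nhds H t₂.toTopologicalSpace x := by
  rw [join, GroupTopology.toTopologicalSpace_inf, nhds_inf]

theorem tendsto_join {ι : Type*} {l : Filter ι} {t₁ t₂ : GroupTopology H} {f : ι → H} {x : H}
    (h₁ : Tendsto f l (@nhds H t₁.toTopologicalSpace x))
    (h₂ : Tendsto f l (@nhds H t₂.toTopologicalSpace x)) :
    Tendsto f l (@nhds H (join t₁ t₂).toTopologicalSpace x) := by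
  rw [nhds_join]
  exact tendsto_inf.2 ⟨h₁, h₂⟩

theorem tendsto_inv_mul_of_tendsto (t : GroupTopology H) {x : ℕ → H} {y : H}
    (h : Tendsto x atTop (@nhds H t.toTopologicalSpace y)) :
    Tendsto (fun p : ℕ × ℕ => (x p.1)⁻¹ * x p.2) (atTop ×ˢ atTop)
      (@nhds H t.toTopologicalSpace 1) := by
  let := t.toTopologicalSpace
  have := t.toIsTopologicalGroup
  simpa using (h.comp tendsto_fst).inv.mul (h.comp tendsto_snd)

theorem tendsto_mul_inv_of_tendsto (t : GroupTopology H) {x : ℕ → H} {y : H}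
    (h : Tendsto x atTop (@nhds H t.toTopologicalSpace y)) :
    Tendsto (fun p : ℕ × ℕ => x p.2 * (x p.1)⁻¹) (atTop ×ˢ atTop)
      (@nhds H t.toTopologicalSpace 1) := by
  let := t.toTopologicalSpace
  have := t.toIsTopologicalGroup
  simpa using (h.comp tendsto_snd).mul (h.comp tendsto_fst).inv

theorem eq_of_mapClusterPt_of_tendsto (t : GroupTopology H)
    (hT : @T2Space H t.toTopologicalSpace) {x : ℕ → H} {y z : H}
    (hy : (@nhds H t.toTopologicalSpace y ⊓ map x atTop).NeBot)
    (hz : Tendsto x atTop (@nhds H t.toTopologicalSpace z)) : y = z := by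
  let := t.toTopologicalSpace
  exact eq_of_nhds_neBot (hy.mono (inf_le_inf_left _ hz))

/-- A sequence with different limits in two Hausdorff group topologies has no cluster point in
their join. -/
theorem not_clusterPt_join {t₁ t₂ : GroupTopology H} (h₁ : @T2Space H t₁.toTopologicalSpace)
    (h₂ : @T2Space H t₂.toTopologicalSpace) {x : ℕ → H} {y₁ y₂ : H} (hne : y₁ ≠ y₂)
    (hx₁ : Tendsto x atTop (@nhds H t₁.toTopologicalSpace y₁))
    (hx₂ : Tendsto x atTop (@nhds H t₂.toTopologicalSpace y₂)) (y : H) :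
    ¬ (@nhds H (join t₁ t₂).toTopologicalSpace y ⊓ map x atTop).NeBot := by
  intro hy
  rw [nhds_join] at hy
  have e₁ := eq_of_mapClusterPt_of_tendsto t₁ h₁ (hy.mono (inf_le_inf_right _ inf_le_left)) hx₁
  have e₂ := eq_of_mapClusterPt_of_tendsto t₂ h₂ (hy.mono (inf_le_inf_right _ inf_le_right)) hx₂
  exact hne (e₁.symm.trans e₂)

theorem not_isComplete_join {t₁ t₂ : GroupTopology H} (h₁ : @T2Space H t₁.toTopologicalSpace)
    (h₂ : @T2Space H t₂.toTopologicalSpace) {x : ℕ → H} {y₁ y₂ : H} (hne : y₁ ≠ y₂)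
    (hx₁ : Tendsto x atTop (@nhds H t₁.toTopologicalSpace y₁))
    (hx₂ : Tendsto x atTop (@nhds H t₂.toTopologicalSpace y₂)) :
    ¬ IsComplete (join t₁ t₂) := by
  intro hc
  have hl := tendsto_join (tendsto_inv_mul_of_tendsto t₁ hx₁) (tendsto_inv_mul_of_tendsto t₂ hx₂)
  have hr := tendsto_join (tendsto_mul_inv_of_tendsto t₁ hx₁) (tendsto_mul_inv_of_tendsto t₂ hx₂)
  let := (join t₁ t₂).toTopologicalSpace
  have := (join t₁ t₂).toIsTopologicalGroup
  have hcauchy : @Cauchy H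
      (IsTopologicalGroup.leftUniformSpace H ⊓ IsTopologicalGroup.rightUniformSpace H)
      (map x atTop) := by
    refine ⟨inferInstance, ?_⟩
    -- Cauchy for the two-sided uniformity means that both x_k⁻¹ x_l and x_l x_k⁻¹ tend to 1.
    rw [inf_uniformity, prod_map_map_eq]
    refine le_inf (map_le_iff_le_comap.1 ?_) (map_le_iff_le_comap.1 ?_)
    · exact hl
    · exact hr
  obtain ⟨y, hy⟩ := hc.complete hcauchy
  rw [UniformSpace.toTopologicalSpace_inf, nhds_inf] at hy
  have hy' : map x atTop ≤ 𝓝 y := hy.trans inf_le_left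
  exact not_clusterPt_join h₁ h₂ hne hx₁ hx₂ y ((inf_eq_right.2 hy').symm ▸ inferInstance)

/-- Countability supplies the enumeration `e` that makes the compact sets exhaust the group. -/
theorem not_isDetermined_join [Countable H] {t₁ t₂ : GroupTopology H}
    (h₁ : @T2Space H t₁.toTopologicalSpace)
    (h₂ : @T2Space H t₂.toTopologicalSpace) {x : ℕ → H} {y₁ y₂ : H} (hne : y₁ ≠ y₂)
    (hx₁ : Tendsto x atTop (@nhds H t₁.toTopologicalSpace y₁))
    (hx₂ : Tendsto x atTop (@nhds H t₂.toTopologicalSpace y₂)) :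
    ¬ IsDetermined (join t₁ t₂) := by
  rintro ⟨d, hd, heq⟩
  have hl := tendsto_join (tendsto_inv_mul_of_tendsto t₁ hx₁) (tendsto_inv_mul_of_tendsto t₂ hx₂)
  have hno := not_clusterPt_join h₁ h₂ hne hx₁ hx₂
  rw [heq] at hl hno
  obtain ⟨e, he⟩ := exists_surjective_nat H
  obtain ⟨n, hn⟩ := frequently_mem_products_of_cauchy d e he hd.t2Space_strongest (x := x) (by
    intro U hU
    obtain ⟨N, hN⟩ := eventually_atTop.1 (prod_atTop_atTop_eq (α := ℕ) (β := ℕ) ▸ hl hU)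
    exact ⟨max N.1 N.2, fun k hk l hl =>
      hN (k, l) ⟨(le_max_left _ _).trans hk, (le_max_right _ _).trans hl⟩⟩)
  let := (strongest d).toTopologicalSpace
  have := (strongest d).toIsTopologicalGroup
  obtain ⟨y, -, hy⟩ :=
    (isCompact_products e (isLeast_strongest d).1 n).exists_mapClusterPt_of_frequently hn
  exact hno y hy

theorem join_strongest_not_isComplete_not_isDetermined [Countable H] {a b : ℕ → H}
    (ha : IsTSequence a) (hb : IsTSequence b)
    (hg : ∃ g : H, g ≠ 1 ∧ ∀ n₀ : ℕ, ∃ n m : ℕ, n₀ ≤ n ∧ n₀ ≤ m ∧ g = (a n)⁻¹ * b m) :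
    ¬ IsComplete (join (strongest a) (strongest b)) ∧
      ¬ IsDetermined (join (strongest a) (strongest b)) := by
  obtain ⟨g, hg1, hg⟩ := hg
  choose n m hn hm hgnm using hg
  have hb₂ : Tendsto (fun k => b (m k)) atTop (@nhds H (strongest b).toTopologicalSpace 1) :=
    Tendsto.comp (isLeast_strongest b).1 (tendsto_atTop_mono hm tendsto_id)
  have hb₁ : Tendsto (fun k => b (m k)) atTop (@nhds H (strongest a).toTopologicalSpace g) := by
    let := (strongest a).toTopologicalSpace
    have := (strongest a).toIsTopologicalGroup
    have h : Tendsto (fun k => a (n k)) atTop (𝓝 1) :=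
      Tendsto.comp (isLeast_strongest a).1 (tendsto_atTop_mono hn tendsto_id)
    have h' := h.mul_const g
    rw [one_mul] at h'
    exact h'.congr fun k => by rw [hgnm k, mul_inv_cancel_left]
  exact ⟨not_isComplete_join ha.t2Space_strongest hb.t2Space_strongest hg1 hb₁ hb₂,
    not_isDetermined_join ha.t2Space_strongest hb.t2Space_strongest hg1 hb₁ hb₂⟩

end Join

/-! ### T-sequences of integers from p-adic topologies -/

section Padic

/-- The `p`-adic topology on the integers. -/
noncomputable def padicTopology (p : ℕ) [Fact p.Prime] : GroupTopology (Multiplicative ℤ) where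
  toTopologicalSpace := TopologicalSpace.induced
    (AddMonoidHom.toMultiplicative (Int.castAddHom ℤ_[p])) inferInstance
  toIsTopologicalGroup := topologicalGroup_induced _

theorem convergesToOne_padicTopology (p : ℕ) [Fact p.Prime] {f : ℕ → ℤ}
    (hf : ∀ n, (p : ℤ) ^ n ∣ f n) :
    ConvergesToOne (padicTopology p) fun n => Multiplicative.ofAdd (f n) := by
  have h : Tendsto (fun n => (f n : ℤ_[p])) atTop (𝓝 0) := by
    have hp : (1 : ℝ) < p := by exact_mod_cast (Fact.out : p.Prime).one_lt
    refine squeeze_zero_norm (a := fun n => ((p : ℝ)⁻¹) ^ n) (fun n => ?_)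
      (tendsto_pow_atTop_nhds_zero_of_lt_one (by positivity) (inv_lt_one_of_one_lt₀ hp))
    have := (PadicInt.norm_int_le_pow_iff_dvd (p := p) (k := f n) (n := n)).2 (by exact_mod_cast hf n)
    simpa [zpow_neg, inv_pow] using this
  change Tendsto _ _ (@nhds _ (TopologicalSpace.induced _ _) _)
  rw [nhds_induced, tendsto_comap_iff, map_one]
  exact h

/-- A sequence of integers whose `n`-th term is divisible by `p ^ n` is a `T`-sequence. -/
theorem isTSequence_of_pow_dvd (p : ℕ) [Fact p.Prime] {f : ℕ → ℤ}
    (hf : ∀ n, (p : ℤ) ^ n ∣ f n) : IsTSequence fun n => Multiplicative.ofAdd (f n) := by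
  refine ⟨padicTopology p, ?_, ?_, convergesToOne_padicTopology p hf⟩
  · let := (padicTopology p).toTopologicalSpace
    refine T2Space.of_injective_continuous
      (f := AddMonoidHom.toMultiplicative (Int.castAddHom ℤ_[p])) ?_ continuous_induced_dom
    intro u v h
    exact Int.cast_injective (α := ℤ_[p]) h
  -- The powers of p are nonzero but tend to 0, impossible in a discrete topology.
  · intro hd
    have h := convergesToOne_padicTopology p (f := fun n => (p : ℤ) ^ n) fun n => dvd_rfl
    let := (padicTopology p).toTopologicalSpace
    rw [ConvergesToOne, nhds_discrete, tendsto_pure] at h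
    obtain ⟨n, hn⟩ := h.exists
    exact pow_ne_zero n (Int.natCast_ne_zero.2 (Fact.out : p.Prime).ne_zero)
      (Multiplicative.ofAdd.injective hn)

/-- Bézout gives u 2ⁿ + v 3ⁿ = 1. Then a_n = -c u 2ⁿ tends to 0 2-adically, while a_n + c = c v 3ⁿ
does so 3-adically. -/
theorem exists_isTSequence_add_const (c : ℤ) :
    ∃ a : ℕ → ℤ, IsTSequence (fun n => Multiplicative.ofAdd (a n)) ∧
      IsTSequence (fun n => Multiplicative.ofAdd (a n + c)) := by
  have hcop : ∀ n : ℕ, IsCoprime ((2 : ℤ) ^ n) (3 ^ n) := fun n =>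
    IsCoprime.pow ⟨-1, 1, by norm_num⟩
  choose u v huv using hcop
  refine ⟨fun n => -c * u n * 2 ^ n, isTSequence_of_pow_dvd 2 fun n => ?_,
    isTSequence_of_pow_dvd 3 fun n => ?_⟩
  · exact Dvd.intro_left _ rfl
  · exact ⟨c * v n, by push_cast; linear_combination (-c) * huv n⟩

end Padic

end TSeq

theorem theorem5 :
    (∀ (G : Type*) [Group G] [Countable G] (a b : ℕ → G),
      TSeq.IsTSequence a → TSeq.IsTSequence b →
      (∃ g : G, g ≠ 1 ∧
        ∀ n₀ : ℕ, ∃ n m : ℕ, n₀ ≤ n ∧ n₀ ≤ m ∧ g = (a n)⁻¹ * b m) →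
      ¬ TSeq.IsComplete (TSeq.join (TSeq.strongest a) (TSeq.strongest b)) ∧
      ¬ TSeq.IsDetermined (TSeq.join (TSeq.strongest a) (TSeq.strongest b))) ∧
    (∀ (c : ℤ), c ≠ 0 →
      (∀ a : ℕ → ℤ,
        TSeq.IsTSequence (fun n => Multiplicative.ofAdd (a n)) →
        TSeq.IsTSequence (fun n => Multiplicative.ofAdd (a n + c)) →
        ¬ TSeq.IsComplete (TSeq.join
            (TSeq.strongest fun n => Multiplicative.ofAdd (a n))
            (TSeq.strongest fun n => Multiplicative.ofAdd (a n + c))) ∧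
        ¬ TSeq.IsDetermined (TSeq.join
            (TSeq.strongest fun n => Multiplicative.ofAdd (a n))
            (TSeq.strongest fun n => Multiplicative.ofAdd (a n + c)))) ∧
      ∃ a : ℕ → ℤ,
        TSeq.IsTSequence (fun n => Multiplicative.ofAdd (a n)) ∧
        TSeq.IsTSequence (fun n => Multiplicative.ofAdd (a n + c))) := by

  -- For the integers take g = c and n = m, since -a_n + (a_n + c) = c.
  refine ⟨fun G _ _ a b => TSeq.join_strongest_not_isComplete_not_isDetermined, fun c hc =>
    ⟨fun a ha ha' => TSeq.join_strongest_not_isComplete_not_isDetermined ha ha'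
      ⟨Multiplicative.ofAdd c, fun h => hc (Multiplicative.ofAdd.injective h), fun n =>
        ⟨n, n, le_rfl, le_rfl, ?_⟩⟩,
    TSeq.exists_isTSequence_add_const c⟩⟩
  rw [← ofAdd_neg, ← ofAdd_add, neg_add_cancel_left]
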